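/- Let $\lambda\in\mathbb R$. A $(1/2,\lambda)$-random Fibonacci sequence with initial values $a,b>0$ is the random sequence $(g_n)_{n\ge1}$ defined by $g_1=a$, $g_2=b$ and $g_n=|\lambda g_{n-1}\pm g_{n-2}|$ for $n\ge 3$, where the $\pm$ signs are chosen by independent tosses of a balanced coin. Fix $a,b>0$ and $\delta>0$, and assume that for every $\lambda\in(2-\delta,2]$ the expected value of the $n$-th term of the $(1/2,\lambda)$-random Fibonacci sequence with initial values $a,b$ has exponential growth rate $\mathcal G(\lambda)$, that is, $\mathcal G(\lambda)=\lim_{n\to\infty}\mathbb E(g_n)^{1/n}$. Regularity of $\mathcal G$ at $2$ is understood from the left, i.e. for $\mathcal G$ as a function on $(2-\delta,2]$. 1. If $\mathcal G$ is differentiable at $2$, then $\mathcal G'(2)=1$. 2. For every $n\in\mathbb N$, if $\mathcal G$ is of class $C^n$ at $2$, then $\mathcal G^{(i)}(2)=0$ for every integer $i$ with $2\le i\le n$. 3. $\mathcal G$ is not analytic at $2$. -/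

import Mathlib

open MeasureTheory ProbabilityTheory Filter Topology

/-- `X` is a sequence of independent tosses of a coin on the probability space `(Ω, μ)`,
each toss being `true` with probability `p` and `false` with probability `1 - p`. -/
structure IsCoinSequence {Ω : Type*} [MeasurableSpace Ω] (μ : Measure Ω) (p : ℝ)
    (X : ℕ → Ω → Bool) : Prop where
  measurable : ∀ n, Measurable (X n)
  indep : iIndepFun X μ
  prob : ∀ n, μ.real {ω | X n ω = true} = p

/-- The sequence `g` with `g 1 = a`, `g 2 = b` and, for `n ≥ 3`,
`g n = |lam * g (n - 1) ± g (n - 2)|`, where the sign is `+` if `x n = true` and `-` otherwise.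
The value at `0` is not used. -/
noncomputable def randFib (lam a b : ℝ) (x : ℕ → Bool) : ℕ → ℝ
  | 0 => 0
  | 1 => a
  | 2 => b
  | n + 3 => |lam * randFib lam a b x (n + 2) +
      (if x (n + 3) = true then 1 else -1) * randFib lam a b x (n + 1)|

/-- Expected value of the `n`-th term of the random Fibonacci sequence with parameter `lam` and
first two terms `a`, `b`, whose signs are given by the coin tosses `X`. -/
noncomputable def expectedFib {Ω : Type*} [MeasurableSpace Ω] (μ : Measure Ω) (X : ℕ → Ω → Bool)
    (lam a b : ℝ) (n : ℕ) : ℝ :=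
  ∫ ω, randFib lam a b (fun i => X i ω) n ∂μ

/-- The expected value `m n` of the `n`-th term has exponential growth rate `r`:
`(m n) ^ (1 / n)` tends to `r`. -/
def HasExpectedGrowthRate {Ω : Type*} [MeasurableSpace Ω] (μ : Measure Ω) (X : ℕ → Ω → Bool)
    (lam a b r : ℝ) : Prop :=
  Tendsto (fun n : ℕ => (expectedFib μ X lam a b n) ^ ((1 : ℝ) / (n : ℝ))) atTop (𝓝 r)

/-!
The argument only looks at the parameters `λ_k = 2 * cos (π / k)`, which increase to `2`. For these
the growth rate is squeezed: `λ_k < G λ_k ≤ λ_k + 8 * 2⁻ᵏ`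
(`growthRate_two_mul_cos_bounds`). Since `2 - λ_k ≥ 4 / k ^ 2`, the function `G - id` is nonzero
along a sequence tending to `2` from the left, but vanishes along it faster than every power of
the distance to `2`. Hence `G` takes the value `2` at `2` when it is continuous there, every left
Taylor coefficient of `G - id` at `2` that exists is zero, and `G - id` cannot be analytic
(`regularity_of_flat_along`).

For the squeeze, follow the state `(x, y) = (g (n - 1), g n)`. A fair toss sends it to
`(y, λ * y + x)` or `(y, |λ * y - x|)`, so the mean of the new term is `λ * y + (x - λ * y)⁺`.
Thus `E g` grows at least like `λ ^ n`, and the excess over this rate is governed by the mean of the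
defect `(x - λ * y)⁺`. All expectations are written with a deterministic averaging operator
`transfer` on functions of the state (`integral_fibState`).

* Upper bound: after a `+` the ratio `y / x` is at least `λ = sin (2θ) / sin θ`, where `θ = π / k`,
  and each `-` lowers it at most to the next quotient `sin ((i + 2) θ) / sin ((i + 1) θ)`. So the
  defect can be positive only after `k - 2` consecutive `-`
  (`transfer_pow_fibDefect_eq_zero`). This has probability `2 ^ (2 - k)`, and along these tosses the
  terms grow at most like `λ ^ n`, as the means do.
* Lower bound: along `k - 1` consecutive `-`, summing the recurrence
  `g (i + 1) - λ * g i + g (i - 1) = 2 * defect` against the weights `sin (i θ)`, which solve the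
  recurrence without defect and vanish at `i = k`, bounds the sum of the defects below by a
  positive multiple of the initial term (`sum_sin_mul_fibDefect`). This gives a fixed relative gain
  over `λ ^ k` in every block of `k` steps.
-/

/-! ### Functions that are flat along a sequence -/

/-- If `H` is `o((x - c) ^ p)` for every `p` along some sequence tending to `c` from the left, then all
left derivatives of `H` at `c`, up to the order of smoothness of `H`, vanish: by Taylor's theorem the
first nonzero one would dominate along the sequence. -/
theorem iteratedDerivWithin_Iic_eq_zero_of_isLittleO {H : ℝ → ℝ} {c : ℝ} {s : ℕ → ℝ}
    (hs : Tendsto s atTop (𝓝[<] c))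
    (hflat : ∀ p : ℕ, (fun k => H (s k)) =o[atTop] fun k => (s k - c) ^ p)
    {n : ℕ} (hH : ContDiffWithinAt ℝ n H (Set.Iic c) c) (i : ℕ) (hi : i ≤ n) :
    iteratedDerivWithin i H (Set.Iic c) c = 0 := by
  induction i using Nat.strong_induction_on with
  | _ i ih =>
  have hHi : ContDiffWithinAt ℝ i H (Set.Iic c) c := hH.of_le (by exact_mod_cast hi)
  obtain ⟨u, huo, hcu, hu⟩ := hHi.contDiffOn' le_rfl (by simp)
  rw [Set.insert_eq_of_mem Set.self_mem_Iic] at hu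
  obtain ⟨ε, hε, hball⟩ := Metric.isOpen_iff.1 huo c hcu
  have hconv : Convex ℝ (Set.Iic c ∩ Metric.ball c ε) :=
    (convex_Iic c).inter (convex_ball c ε)
  have hcs : c ∈ Set.Iic c ∩ Metric.ball c ε := ⟨Set.self_mem_Iic, Metric.mem_ball_self hε⟩
  have htaylor := taylor_isLittleO hconv hcs
    (hu.mono (Set.inter_subset_inter_right _ hball))
  rw [nhdsWithin_inter_of_mem' (mem_nhdsWithin_of_mem_nhds (Metric.ball_mem_nhds c hε))] at htaylor
  have hderiv : ∀ j, iteratedDerivWithin j H (Set.Iic c ∩ Metric.ball c ε) c =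
      iteratedDerivWithin j H (Set.Iic c) c := fun j => by
    simp only [iteratedDerivWithin_eq_iteratedFDerivWithin,
      iteratedFDerivWithin_inter_open Metric.isOpen_ball (Metric.mem_ball_self hε)]
  have hs' : Tendsto s atTop (𝓝[≤] c) :=
    hs.mono_right (nhdsWithin_mono _ Set.Iio_subset_Iic_self)
  have hmain := (hflat i).sub (htaylor.comp_tendsto hs')
  -- By induction, only the top term of the Taylor polynomial of order `i` survives.
  have heval : ∀ x, taylorWithinEval H i (Set.Iic c ∩ Metric.ball c ε) c x =
      ((i.factorial : ℝ)⁻¹ * iteratedDerivWithin i H (Set.Iic c) c) * (x - c) ^ i := by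
    intro x
    rw [taylor_within_apply, Finset.sum_range_succ, Finset.sum_eq_zero, hderiv]
    · simp only [smul_eq_mul]; ring
    · intro j hj
      rw [Finset.mem_range] at hj
      rw [hderiv, ih j hj (hj.le.trans hi), smul_zero]
  simp only [Function.comp_def, sub_sub_cancel, heval] at hmain
  by_contra hne
  have hcoef : ((i.factorial : ℝ)⁻¹ * iteratedDerivWithin i H (Set.Iic c) c) ≠ 0 :=
    mul_ne_zero (by positivity) hne
  rw [Asymptotics.isLittleO_const_mul_left_iff hcoef] at hmain
  refine Asymptotics.isLittleO_irrefl (Eventually.frequently ?_) hmain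
  filter_upwards [hs.eventually self_mem_nhdsWithin] with k hk
  exact pow_ne_zero _ (sub_ne_zero.2 (ne_of_lt hk))

/-- A nonzero analytic germ at `c` is `(x - c) ^ p` times a unit, so it cannot be flat along a
sequence tending to `c` unless it vanishes there. -/
theorem not_analyticAt_of_isLittleO {H : ℝ → ℝ} {c : ℝ} {s : ℕ → ℝ}
    (hs : Tendsto s atTop (𝓝[<] c))
    (hflat : ∀ p : ℕ, (fun k => H (s k)) =o[atTop] fun k => (s k - c) ^ p)
    (hne : ∀ᶠ k in atTop, H (s k) ≠ 0) : ¬ AnalyticAt ℝ H c := by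
  intro hH
  have hs' : Tendsto s atTop (𝓝 c) := hs.mono_right nhdsWithin_le_nhds
  have hnz : ¬ ∀ᶠ z in 𝓝 c, H z = 0 := fun h => by
    obtain ⟨k, h1, h2⟩ := (hne.and (hs'.eventually h)).exists
    exact h1 h2
  obtain ⟨p, g, hg, hgc, hfac⟩ := hH.exists_eventuallyEq_pow_smul_nonzero_iff.2 hnz
  have hO : (fun k => (s k - c) ^ p) =O[atTop] fun k => H (s k) := by
    have h1 : (fun _ : ℕ => (1 : ℝ)) =O[atTop] fun k => g (s k) :=
      (Asymptotics.isBigO_const_left_iff_pos_le_norm one_ne_zero).2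
        ⟨‖g c‖ / 2, by positivity, by
          have : Tendsto (fun k => ‖g (s k)‖) atTop (𝓝 ‖g c‖) :=
            (hg.continuousAt.tendsto.comp hs').norm
          exact (this.eventually_const_lt (half_lt_self (norm_pos_iff.2 hgc))).mono
            fun _ h => h.le⟩
    have h2 := (Asymptotics.isBigO_refl (fun k => (s k - c) ^ p) atTop).mul h1
    refine (h2.congr_left fun k => mul_one _).trans_eventuallyEq ?_
    filter_upwards [hs'.eventually hfac] with k hk
    rw [hk, smul_eq_mul]
  refine Asymptotics.isLittleO_irrefl (Eventually.frequently hne) ((hflat p).trans_isBigO hO)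

theorem derivWithin_Iic_eq_one_of_isLittleO {G : ℝ → ℝ} {c : ℝ} {s : ℕ → ℝ}
    (hs : Tendsto s atTop (𝓝[<] c)) (hGc : G c = c)
    (hflat : (fun k => G (s k) - s k) =o[atTop] fun k => s k - c)
    (hG : DifferentiableWithinAt ℝ G (Set.Iic c) c) :
    derivWithin G (Set.Iic c) c = 1 := by
  have h1 := hG.hasDerivWithinAt.isLittleO.comp_tendsto
    (hs.mono_right (nhdsWithin_mono _ Set.Iio_subset_Iic_self))
  have h2 := hflat.sub h1
  simp only [Function.comp_def, hGc, smul_eq_mul] at h2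
  by_contra hne
  have h3 : (fun k => (derivWithin G (Set.Iic c) c - 1) * (s k - c)) =o[atTop]
      fun k => s k - c := h2.congr_left fun k => by ring
  rw [Asymptotics.isLittleO_const_mul_left_iff (sub_ne_zero.2 hne)] at h3
  refine Asymptotics.isLittleO_irrefl (Eventually.frequently ?_) h3
  filter_upwards [hs.eventually self_mem_nhdsWithin] with k hk
  exact sub_ne_zero.2 (ne_of_lt hk)

/-- If `G` agrees with the identity to infinite order along a sequence tending to `c` from the left,
without ever coinciding with it there, then the left derivatives of `G` at `c` that exist are those
of the identity, and `G` is not analytic at `c` from the left. -/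
theorem regularity_of_flat_along {G : ℝ → ℝ} {c : ℝ} {s : ℕ → ℝ}
    (hs : Tendsto s atTop (𝓝[<] c))
    (hflat : ∀ p : ℕ, (fun k => G (s k) - s k) =o[atTop] fun k => (s k - c) ^ p)
    (hne : ∀ᶠ k in atTop, G (s k) ≠ s k) :
    (DifferentiableWithinAt ℝ G (Set.Iic c) c → derivWithin G (Set.Iic c) c = 1) ∧
    (∀ n : ℕ, ContDiffWithinAt ℝ n G (Set.Iic c) c →
      ∀ i : ℕ, 2 ≤ i → i ≤ n → iteratedDerivWithin i G (Set.Iic c) c = 0) ∧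
    ¬ AnalyticWithinAt ℝ G (Set.Iic c) c := by
  have hsc : Tendsto s atTop (𝓝 c) := hs.mono_right nhdsWithin_le_nhds
  have hs' : Tendsto s atTop (𝓝[≤] c) :=
    hs.mono_right (nhdsWithin_mono _ Set.Iio_subset_Iic_self)
  refine ⟨fun hG => ?_, fun n hG i hi2 hin => ?_, fun hG => ?_⟩
  · refine derivWithin_Iic_eq_one_of_isLittleO hs ?_ (by simpa using hflat 1) hG
    have h1 : Tendsto (fun k => G (s k)) atTop (𝓝 (G c)) :=
      hG.continuousWithinAt.tendsto.comp hs'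
    have h2 : Tendsto (fun k => G (s k) - s k) atTop (𝓝 0) := by
      have := hflat 0
      simp only [pow_zero] at this
      exact (Asymptotics.isLittleO_one_iff ℝ).1 this
    have h3 := h2.add hsc
    simp only [sub_add_cancel, zero_add] at h3
    exact tendsto_nhds_unique h1 h3
  · have hH : ContDiffWithinAt ℝ n (G - id) (Set.Iic c) c := hG.sub contDiffWithinAt_id
    have h0 := iteratedDerivWithin_Iic_eq_zero_of_isLittleO (H := G - id) hs hflat hH i hin
    have hin' : (i : WithTop ℕ∞) ≤ n := by exact_mod_cast hin
    rw [iteratedDerivWithin_sub Set.self_mem_Iic (uniqueDiffOn_Iic c) (hG.of_le hin')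
      contDiffWithinAt_id, iteratedDerivWithin_id Set.self_mem_Iic (uniqueDiffOn_Iic c)] at h0
    simpa [show i ≠ 0 by omega, show i ≠ 1 by omega] using h0
  · obtain ⟨g, -, hgG, hg⟩ := analyticWithinAt_iff_exists_analyticAt'.1 hG
    have hgs : ∀ᶠ k in atTop, G (s k) = g (s k) := by
      filter_upwards [hs'.eventually self_mem_nhdsWithin] with k hk
      exact hgG (Set.mem_insert_of_mem _ hk)
    refine not_analyticAt_of_isLittleO (H := g - id) hs (fun p => ?_) ?_ (hg.sub analyticAt_id)
    · refine (hflat p).congr' ?_ EventuallyEq.rfl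
      filter_upwards [hgs] with k hk
      simp [hk]
    · filter_upwards [hgs, hne] with k hk hk'
      simpa [← hk, sub_eq_zero] using hk'

/-! ### Expectations as iterates of an averaging operator -/

/-- One step of the recurrence on states `(g (n - 1), g n)`, with sign `s`, which is `1` or `-1` in all
uses. -/
noncomputable def fibStep (lam s : ℝ) (p : ℝ × ℝ) : ℝ × ℝ := (p.2, |lam * p.2 + s * p.1|)

/-- The averaging operator of the Markov chain of states: `transfer lam f p` is the mean of `f` after
one step with a fair sign from the state `p`. -/
noncomputable def transfer (lam : ℝ) : (ℝ × ℝ → ℝ) →ₗ[ℝ] (ℝ × ℝ → ℝ) where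
  toFun f p := (f (fibStep lam 1 p) + f (fibStep lam (-1) p)) / 2
  map_add' f g := by ext p; simp only [Pi.add_apply]; ring
  map_smul' c f := by ext p; simp only [Pi.smul_apply, smul_eq_mul, RingHom.id_apply]; ring

theorem transfer_apply (lam : ℝ) (f : ℝ × ℝ → ℝ) (p : ℝ × ℝ) :
    transfer lam f p = (f (fibStep lam 1 p) + f (fibStep lam (-1) p)) / 2 := rfl

theorem transfer_pow_succ_apply (lam : ℝ) (n : ℕ) (f : ℝ × ℝ → ℝ) :
    (transfer lam ^ (n + 1)) f = transfer lam ((transfer lam ^ n) f) := by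
  rw [pow_succ', Module.End.mul_apply]

/-- The pair of consecutive terms with indices `n + 1` and `n + 2`; for `n = 0` these are the initial
values. -/
noncomputable def fibState (lam a b : ℝ) (x : ℕ → Bool) (n : ℕ) : ℝ × ℝ :=
  (randFib lam a b x (n + 1), randFib lam a b x (n + 2))

theorem fibState_succ (lam a b : ℝ) (x : ℕ → Bool) (n : ℕ) :
    fibState lam a b x (n + 1) =
      fibStep lam (if x (n + 3) = true then 1 else -1) (fibState lam a b x n) := by
  simp [fibState, fibStep, randFib]

theorem fibState_congr (lam a b : ℝ) {x y : ℕ → Bool} (n : ℕ) (h : ∀ i < n + 3, x i = y i) :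
    fibState lam a b x n = fibState lam a b y n := by
  induction n with
  | zero => simp [fibState, randFib]
  | succ n ih =>
    rw [fibState_succ, fibState_succ, ih fun i hi => h i (by omega), h (n + 3) (by omega)]

section Expectation

variable {Ω : Type*} [MeasurableSpace Ω] {μ : Measure Ω} {X : ℕ → Ω → Bool}

/-- The Markov property: the state with index `n` is determined by tosses with index below `n + 3`, and
the toss with index `n + 3` is fair and independent of them. -/
theorem integral_fibState_succ [IsProbabilityMeasure μ]
    (hX : IsCoinSequence μ (1 / 2) X) (lam a b : ℝ) (f : ℝ × ℝ → ℝ) (n : ℕ) :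
    ∫ ω, f (fibState lam a b (fun i => X i ω) (n + 1)) ∂μ =
      ∫ ω, transfer lam f (fibState lam a b (fun i => X i ω) n) ∂μ := by
  let past : Ω → (Finset.range (n + 3) → Bool) := fun ω i => X i ω
  let state : (Finset.range (n + 3) → Bool) → ℝ × ℝ := fun y =>
    fibState lam a b (fun i => if h : i ∈ Finset.range (n + 3) then y ⟨i, h⟩ else false) n
  have hpast : Measurable past := measurable_pi_lambda _ fun i => hX.measurable i
  have hstate : ∀ ω, fibState lam a b (fun i => X i ω) n = state (past ω) := fun ω =>
    fibState_congr lam a b n fun i hi => by simp [past, hi]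
  have hind : IndepFun past (X (n + 3)) μ := by
    have h := hX.indep.indepFun_finset (Finset.range (n + 3)) {n + 3} (by simp) hX.measurable
    exact h.comp (φ := id) (ψ := fun y => y ⟨n + 3, by simp⟩) measurable_id
      .of_discrete
  have hint : ∀ F : (Finset.range (n + 3) → Bool) → ℝ, Integrable (fun ω => F (past ω)) μ :=
    fun F => (Integrable.of_finite (μ := μ.map past) (f := F)).comp_measurable hpast
  -- A function of the past times a fair sign averages to zero.
  have hsign : ∀ F : (Finset.range (n + 3) → Bool) → ℝ,
      ∫ ω, F (past ω) * (if X (n + 3) ω = true then 1 else -1 : ℝ) ∂μ = 0 := by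
    intro F
    have hcomp := hind.comp (φ := F) (ψ := fun s : Bool => if s = true then (1 : ℝ) else -1)
      .of_discrete .of_discrete
    have hmul := hcomp.integral_fun_mul_eq_mul_integral
      (Measurable.of_discrete.comp hpast).aestronglyMeasurable
      (Measurable.of_discrete.comp (hX.measurable _)).aestronglyMeasurable
    have hset : MeasurableSet {ω | X (n + 3) ω = true} :=
      hX.measurable (n + 3) (MeasurableSet.singleton true)
    have hzero : ∫ ω, (if X (n + 3) ω = true then 1 else -1 : ℝ) ∂μ = 0 := by
      have hrw : ∀ ω, (if X (n + 3) ω = true then 1 else -1 : ℝ) =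
          2 * {ω | X (n + 3) ω = true}.indicator (fun _ => (1 : ℝ)) ω - 1 := by
        intro ω
        by_cases h : X (n + 3) ω = true <;> simp [h] ; norm_num
      simp_rw [hrw]
      rw [integral_sub (((integrable_const _).indicator hset).const_mul _) (integrable_const _),
        integral_const_mul, integral_indicator_const _ hset, hX.prob]
      simp
    simp only [Function.comp_def] at hmul
    rw [hmul, hzero, mul_zero]
  -- Split `f` after the step into its mean over the two signs and a multiple of the sign.
  let even : (Finset.range (n + 3) → Bool) → ℝ := fun y => transfer lam f (state y)
  let odd : (Finset.range (n + 3) → Bool) → ℝ := fun y =>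
    (f (fibStep lam 1 (state y)) - f (fibStep lam (-1) (state y))) / 2
  have hsplit : ∀ ω, f (fibState lam a b (fun i => X i ω) (n + 1)) =
      even (past ω) + odd (past ω) * (if X (n + 3) ω = true then 1 else -1 : ℝ) := by
    intro ω
    rw [fibState_succ, hstate]
    simp only [even, odd, transfer_apply]
    split_ifs <;> ring
  have hodd : Integrable
      (fun ω => odd (past ω) * (if X (n + 3) ω = true then 1 else -1 : ℝ)) μ := by
    refine (hint odd).mul_bdd (c := 1)
      (Measurable.of_discrete.comp (hX.measurable (n + 3))
        (g := fun s : Bool => if s = true then (1 : ℝ) else -1)).aestronglyMeasurable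
      (Eventually.of_forall fun ω => ?_)
    split_ifs <;> simp
  simp_rw [hsplit]
  rw [integral_add (hint even) hodd, hsign, add_zero]
  simp only [even, hstate]

theorem integral_fibState [IsProbabilityMeasure μ] (hX : IsCoinSequence μ (1 / 2) X)
    (lam a b : ℝ) (f : ℝ × ℝ → ℝ) (n : ℕ) :
    ∫ ω, f (fibState lam a b (fun i => X i ω) n) ∂μ = (transfer lam ^ n) f (a, b) := by
  induction n generalizing f with
  | zero => simp [fibState, randFib]
  | succ n ih =>
    rw [integral_fibState_succ hX, ih, pow_succ, Module.End.mul_apply]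

/-- The mean of the term with index `n + 1`, as a deterministic quantity; see `expectedFib_succ`. -/
noncomputable def meanFib (lam a b : ℝ) (n : ℕ) : ℝ := (transfer lam ^ n) Prod.fst (a, b)

theorem expectedFib_succ [IsProbabilityMeasure μ] (hX : IsCoinSequence μ (1 / 2) X)
    (lam a b : ℝ) (n : ℕ) : expectedFib μ X lam a b (n + 1) = meanFib lam a b n :=
  integral_fibState hX lam a b Prod.fst n

end Expectation

/-! ### The averaging operator on nonnegative states -/

theorem fibStep_nonneg (lam s : ℝ) {p : ℝ × ℝ} (hp : 0 ≤ p) : 0 ≤ fibStep lam s p :=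
  ⟨hp.2, abs_nonneg _⟩

theorem transfer_pow_mono (lam : ℝ) (n : ℕ) {f g : ℝ × ℝ → ℝ} (h : ∀ p, 0 ≤ p → f p ≤ g p) :
    ∀ p, 0 ≤ p → (transfer lam ^ n) f p ≤ (transfer lam ^ n) g p := by
  induction n with
  | zero => simpa using h
  | succ n ih =>
    intro p hp
    rw [transfer_pow_succ_apply, transfer_pow_succ_apply, transfer_apply, transfer_apply]
    linarith [ih _ (fibStep_nonneg lam 1 hp), ih _ (fibStep_nonneg lam (-1) hp)]

theorem transfer_pow_nonneg (lam : ℝ) (n : ℕ) {f : ℝ × ℝ → ℝ} (h : ∀ p, 0 ≤ p → 0 ≤ f p)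
    {p : ℝ × ℝ} (hp : 0 ≤ p) : 0 ≤ (transfer lam ^ n) f p := by
  simpa using transfer_pow_mono lam n (f := 0) h p hp

/-- For a nonnegative function, the average over `n` tosses is at least the contribution of `n`
minus signs. -/
theorem le_transfer_pow (lam : ℝ) (n : ℕ) {f : ℝ × ℝ → ℝ} (h : ∀ p, 0 ≤ p → 0 ≤ f p) :
    ∀ p, 0 ≤ p → (1 / 2) ^ n * f ((fibStep lam (-1))^[n] p) ≤ (transfer lam ^ n) f p := by
  induction n with
  | zero => simp
  | succ n ih =>
    intro p hp
    rw [transfer_pow_succ_apply, transfer_apply, Function.iterate_succ_apply, pow_succ]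
    linarith [ih _ (fibStep_nonneg lam (-1) hp),
      transfer_pow_nonneg lam n h (fibStep_nonneg lam 1 hp)]

/-- The amount `(x - lam * y)⁺` by which, for nonnegative `x`, `y` and `lam`, the mean of the term after
the state `(x, y)` exceeds `lam * y`. -/
noncomputable def fibDefect (lam : ℝ) (p : ℝ × ℝ) : ℝ := max (p.1 - lam * p.2) 0

theorem fibDefect_nonneg (lam : ℝ) (p : ℝ × ℝ) : 0 ≤ fibDefect lam p := le_max_right _ _

theorem abs_sub_eq_add_fibDefect (lam : ℝ) (p : ℝ × ℝ) :
    |lam * p.2 + -1 * p.1| = lam * p.2 - p.1 + 2 * fibDefect lam p := by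
  unfold fibDefect
  rcases le_total (p.1) (lam * p.2) with h | h
  · rw [abs_of_nonneg (by linarith), max_eq_right (by linarith)]; ring
  · rw [abs_of_nonpos (by linarith), max_eq_left (by linarith)]; ring

theorem transfer_snd {lam : ℝ} (hlam : 0 ≤ lam) {p : ℝ × ℝ} (hp : 0 ≤ p) :
    transfer lam Prod.snd p = lam * p.2 + fibDefect lam p := by
  have h1 : 0 ≤ lam * p.2 + 1 * p.1 := by
    have := mul_nonneg hlam hp.2
    have := hp.1
    simp only [Prod.fst_zero] at this
    linarith
  simp only [transfer_apply, fibStep]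
  rw [abs_sub_eq_add_fibDefect, abs_of_nonneg h1]
  ring

/-! ### Mean values and the defect -/

section Mean

variable {lam a b : ℝ}

theorem meanFib_zero : meanFib lam a b 0 = a := by simp [meanFib]

theorem meanFib_succ (n : ℕ) : meanFib lam a b (n + 1) = (transfer lam ^ n) Prod.snd (a, b) := by
  have h : transfer lam Prod.fst = Prod.snd := by
    ext p; simp [transfer_apply, fibStep]
  rw [meanFib, pow_succ, Module.End.mul_apply, h]

theorem meanFib_one : meanFib lam a b 1 = b := by simp [meanFib_succ]

theorem meanFib_add_two (hlam : 0 ≤ lam) (ha : 0 ≤ a) (hb : 0 ≤ b) (n : ℕ) :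
    meanFib lam a b (n + 2) =
      lam * meanFib lam a b (n + 1) + (transfer lam ^ n) (fibDefect lam) (a, b) := by
  have hab : (0 : ℝ × ℝ) ≤ (a, b) := ⟨ha, hb⟩
  have h : (transfer lam ^ n) (transfer lam Prod.snd) (a, b) =
      (transfer lam ^ n) (lam • Prod.snd + fibDefect lam) (a, b) :=
    le_antisymm
      (transfer_pow_mono lam n (fun p hp => (transfer_snd hlam hp).le) _ hab)
      (transfer_pow_mono lam n (fun p hp => (transfer_snd hlam hp).ge) _ hab)
  rw [meanFib_succ, pow_succ, Module.End.mul_apply, h, map_add, map_smul, meanFib_succ]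
  rfl

theorem mul_meanFib_le (hlam : 0 ≤ lam) (ha : 0 ≤ a) (hb : 0 ≤ b) (n : ℕ) :
    lam * meanFib lam a b (n + 1) ≤ meanFib lam a b (n + 2) := by
  rw [meanFib_add_two hlam ha hb]
  linarith [transfer_pow_nonneg lam n (fun p _ => fibDefect_nonneg lam p)
    (show (0 : ℝ × ℝ) ≤ (a, b) from ⟨ha, hb⟩)]

theorem meanFib_pos (hlam : 0 < lam) (ha : 0 < a) (hb : 0 < b) (n : ℕ) :
    0 < meanFib lam a b n := by
  rcases n with _ | n
  · rwa [meanFib_zero]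
  · induction n with
    | zero => rwa [meanFib_one]
    | succ n ih => exact (mul_pos hlam ih).trans_le (mul_meanFib_le hlam.le ha.le hb.le n)

theorem pow_mul_meanFib_le (hlam : 0 ≤ lam) (ha : 0 ≤ a) (hb : 0 ≤ b) (n j : ℕ) :
    lam ^ j * meanFib lam a b (n + 1) ≤ meanFib lam a b (n + j + 1) := by
  induction j with
  | zero => simp
  | succ j ih =>
    have := mul_le_mul_of_nonneg_left ih hlam
    have := mul_meanFib_le hlam ha hb (n + j)
    rw [pow_succ', mul_assoc]
    exact le_trans ‹_› ‹_›

theorem pow_mul_add_sum_defect_le (hlam : 1 ≤ lam) (ha : 0 ≤ a) (hb : 0 ≤ b) (n j : ℕ) :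
    lam ^ j * meanFib lam a b (n + 1) +
        ∑ i ∈ Finset.range j, (transfer lam ^ (n + i)) (fibDefect lam) (a, b) ≤
      meanFib lam a b (n + j + 1) := by
  have hlam0 : 0 ≤ lam := zero_le_one.trans hlam
  induction j with
  | zero => simp
  | succ j ih =>
    have hsum : 0 ≤ ∑ i ∈ Finset.range j, (transfer lam ^ (n + i)) (fibDefect lam) (a, b) :=
      Finset.sum_nonneg fun i _ => transfer_pow_nonneg lam _ (fun p _ => fibDefect_nonneg lam p)
        ⟨ha, hb⟩
    have h1 := mul_le_mul_of_nonneg_left ih hlam0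
    have h2 := mul_le_mul_of_nonneg_right hlam hsum
    have h3 : meanFib lam a b (n + (j + 1) + 1) = lam * meanFib lam a b (n + j + 1) +
      (transfer lam ^ (n + j)) (fibDefect lam) (a, b) := meanFib_add_two hlam0 ha hb (n + j)
    rw [h3, Finset.sum_range_succ, pow_succ']
    linarith

end Mean

/-! ### Bounds on the defect at `lam = 2 * cos (π / k)` -/

section Trig

open Real

/-- The sequence `sin (t * θ)` solves the recurrence with `lam = 2 * cos θ` and all signs minus. -/
theorem sin_add_one_mul (t θ : ℝ) :
    sin ((t + 1) * θ) = 2 * cos θ * sin (t * θ) - sin ((t - 1) * θ) := by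
  rw [add_mul, sub_mul, one_mul, sin_add, sin_sub]
  ring

theorem sin_mul_pi_div_nonneg {k : ℕ} {t : ℝ} (ht : 0 ≤ t) (htk : t ≤ k) :
    0 ≤ sin (t * (π / k)) := by
  rcases eq_or_lt_of_le (ht.trans htk) with hk | hk
  · simp [← hk]
  · refine sin_nonneg_of_nonneg_of_le_pi (by positivity) ?_
    rw [← mul_div_assoc, div_le_iff₀ hk, mul_comm]
    gcongr

theorem sin_mul_pi_div_pos {k : ℕ} {t : ℝ} (ht : 0 < t) (htk : t < k) :
    0 < sin (t * (π / k)) := by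
  have hk : (0 : ℝ) < k := ht.trans htk
  refine sin_pos_of_pos_of_lt_pi (by positivity) ?_
  rw [← mul_div_assoc, div_lt_iff₀ hk, mul_comm]
  gcongr

/-- After a plus sign, the ratio of consecutive terms is at least `sin (2θ) / sin θ`. -/
theorem fibStep_one_mul_sin_le {k : ℕ} (hk : 1 ≤ k) {lam : ℝ} (hlam : lam = 2 * cos (π / k))
    {p : ℝ × ℝ} (hp : 0 ≤ p) :
    (fibStep lam 1 p).1 * sin (2 * (π / k)) ≤ (fibStep lam 1 p).2 * sin (π / k) := by
  have h1 : 0 ≤ sin (π / k) := by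
    simpa using sin_mul_pi_div_nonneg (k := k) zero_le_one (by exact_mod_cast hk)
  have h2 : sin (2 * (π / k)) = lam * sin (π / k) := by
    rw [sin_two_mul, hlam]; ring
  have h3 := mul_nonneg hp.1 h1
  have h4 := mul_le_mul_of_nonneg_right (le_abs_self (lam * p.2 + 1 * p.1)) h1
  simp only [fibStep]
  rw [h2]
  linarith

/-- If the ratio of consecutive terms is at least `sin ((i + 2) θ) / sin ((i + 1) θ)` with `θ = π / k`,
then no choice of the next `j ≤ k - 3 - i` signs leads to a positive defect: a minus sign raises `i`
by one and a plus sign resets it to `0`. -/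
theorem transfer_pow_fibDefect_eq_zero {k : ℕ} (hk : 3 ≤ k) {lam : ℝ}
    (hlam : lam = 2 * cos (π / k)) (hlam0 : 0 ≤ lam) (j : ℕ) :
    ∀ (i : ℕ) (p : ℝ × ℝ), 0 ≤ p → i + j + 3 ≤ k →
      p.1 * sin ((i + 2) * (π / k)) ≤ p.2 * sin ((i + 1) * (π / k)) →
      (transfer lam ^ j) (fibDefect lam) p = 0 := by
  have hrec : ∀ i : ℕ, sin ((i + 3) * (π / k)) =
      lam * sin ((i + 2) * (π / k)) - sin ((i + 1) * (π / k)) := by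
    intro i
    have := sin_add_one_mul ((i : ℝ) + 2) (π / k)
    rw [hlam]
    convert this using 3 <;> ring_nf
  induction j with
  | zero =>
    rintro i ⟨x, y⟩ ⟨hx, hy⟩ hik h
    have hik' : (i : ℝ) + 3 ≤ k := by exact_mod_cast hik
    have h1 : 0 < sin ((i + 1) * (π / k)) := sin_mul_pi_div_pos (by positivity) (by linarith)
    have h3 : 0 ≤ sin ((i + 3) * (π / k)) := sin_mul_pi_div_nonneg (by positivity) hik'
    simp only [Prod.fst_zero, Prod.snd_zero] at hx hy h
    rw [pow_zero, Module.End.one_apply, fibDefect, max_eq_right]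
    rw [sub_nonpos]
    -- It suffices to compare after multiplying by `sin ((i + 1) θ) > 0`, and
    -- `lam * sin ((i + 2) θ) = sin ((i + 1) θ) + sin ((i + 3) θ) ≥ sin ((i + 1) θ)`.
    refine le_of_mul_le_mul_right ?_ h1
    have h4 := mul_le_mul_of_nonneg_left h hlam0
    have h5 := mul_nonneg hx h3
    rw [hrec] at h5
    simp only
    linarith
  | succ j ih =>
    rintro i p hp hik h
    have hik' : (i : ℝ) + j + 1 + 3 ≤ k := by exact_mod_cast hik
    have hj : (0 : ℝ) ≤ j := j.cast_nonneg
    rw [transfer_pow_succ_apply, transfer_apply, ih 0 _ (fibStep_nonneg lam 1 hp) (by omega),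
      ih (i + 1) _ (fibStep_nonneg lam (-1) hp) (by omega)]
    · simp
    · have h2 : 0 ≤ sin ((i + 2) * (π / k)) :=
        sin_mul_pi_div_nonneg (by positivity) (by linarith)
      have h4 := mul_le_mul_of_nonneg_right (le_abs_self (lam * p.2 + -1 * p.1)) h2
      have e1 : (((i + 1 : ℕ) : ℝ) + 2) = i + 3 := by push_cast; ring
      have e2 : (((i + 1 : ℕ) : ℝ) + 1) = i + 2 := by push_cast; ring
      simp only [fibStep]
      rw [e1, e2, hrec]
      linarith
    · simpa using fibStep_one_mul_sin_le (by omega) hlam hp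

/-- For `j ≤ k - 2` only the path with `j` minus signs contributes to the average of the defect. Its
probability is `2⁻ʲ`, and each of its steps multiplies the larger coordinate by at most `lam`. -/
theorem transfer_pow_fibDefect_le {k : ℕ} (hk : 3 ≤ k) {lam : ℝ}
    (hlam : lam = 2 * cos (π / k)) (hlam1 : 1 ≤ lam) (j : ℕ) (hj : j + 2 ≤ k) :
    ∀ p : ℝ × ℝ, 0 ≤ p →
      (transfer lam ^ j) (fibDefect lam) p ≤ (lam / 2) ^ j * max p.1 p.2 := by
  have hlam0 : 0 ≤ lam := zero_le_one.trans hlam1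
  induction j with
  | zero =>
    rintro ⟨x, y⟩ ⟨hx, hy⟩
    simp only [Prod.fst_zero, Prod.snd_zero] at hx hy
    simp only [pow_zero, Module.End.one_apply, one_mul, fibDefect]
    exact max_le ((sub_le_self _ (mul_nonneg hlam0 hy)).trans (le_max_left _ _))
      (hx.trans (le_max_left _ _))
  | succ j ih =>
    intro p hp
    have h0 : (transfer lam ^ j) (fibDefect lam) (fibStep lam 1 p) = 0 := by
      refine transfer_pow_fibDefect_eq_zero hk hlam hlam0 j 0 _ (fibStep_nonneg lam 1 hp)
        (by omega) ?_
      simpa using fibStep_one_mul_sin_le (by omega) hlam hp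
    have hmax : max (fibStep lam (-1) p).1 (fibStep lam (-1) p).2 ≤ lam * max p.1 p.2 := by
      have hx : 0 ≤ p.1 := hp.1
      have hy : 0 ≤ p.2 := hp.2
      have hM : 0 ≤ max p.1 p.2 := hx.trans (le_max_left _ _)
      have h1 : p.2 ≤ lam * max p.1 p.2 :=
        (le_max_right _ _).trans (le_mul_of_one_le_left hM hlam1)
      have h2 : p.1 ≤ lam * max p.1 p.2 :=
        (le_max_left _ _).trans (le_mul_of_one_le_left hM hlam1)
      have h3 : lam * p.2 ≤ lam * max p.1 p.2 :=
        mul_le_mul_of_nonneg_left (le_max_right _ _) hlam0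
      have h4 := mul_nonneg hlam0 hy
      refine max_le h1 (abs_le.2 ⟨?_, ?_⟩) <;> linarith
    rw [transfer_pow_succ_apply, transfer_apply, h0, pow_succ]
    have h5 := ih (by omega) _ (fibStep_nonneg lam (-1) hp)
    have h6 := mul_le_mul_of_nonneg_left hmax (show 0 ≤ (lam / 2) ^ j by positivity)
    linarith

/-- Summation by parts of the defects along a run of minus signs, against the solution
`sin ((i + 1) * θ)` of the recurrence without defects. -/
theorem sum_sin_mul_fibDefect (θ : ℝ) (p : ℝ × ℝ) (j : ℕ) :
    ∑ i ∈ Finset.range j, 2 * sin ((i + 1) * θ) *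
        fibDefect (2 * cos θ) ((fibStep (2 * cos θ) (-1))^[i] p) =
      sin θ * p.1 + sin (j * θ) * ((fibStep (2 * cos θ) (-1))^[j] p).2 -
        sin ((j + 1) * θ) * ((fibStep (2 * cos θ) (-1))^[j] p).1 := by
  induction j with
  | zero => simp
  | succ j ih =>
    have hrec := sin_add_one_mul ((j : ℝ) + 1) θ
    rw [add_sub_cancel_right] at hrec
    rw [Finset.sum_range_succ, ih, Function.iterate_succ_apply']
    generalize (fibStep (2 * cos θ) (-1))^[j] p = q
    simp only [fibStep, Nat.cast_add, Nat.cast_one]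
    rw [abs_sub_eq_add_fibDefect, hrec]
    ring

theorem le_sum_transfer_pow_fibDefect {k : ℕ} (hk : 3 ≤ k) {lam : ℝ}
    (hlam : lam = 2 * cos (π / k)) (p : ℝ × ℝ) (hp : 0 ≤ p) :
    (1 / 2) ^ k * sin (π / k) * p.1 ≤
      ∑ i ∈ Finset.range (k - 1), (transfer lam ^ i) (fibDefect lam) p := by
  have hsum := sum_sin_mul_fibDefect (π / k) p (k - 1)
  have hk0 : (k : ℝ) ≠ 0 := by positivity
  have hcast : ((k - 1 : ℕ) : ℝ) + 1 = k := by
    rw [Nat.cast_sub (by omega), Nat.cast_one, sub_add_cancel]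
  rw [hcast, mul_div_cancel₀ _ hk0, sin_pi, zero_mul, sub_zero, ← hlam] at hsum
  have hlast : 0 ≤ sin ((k - 1 : ℕ) * (π / k)) :=
    sin_mul_pi_div_nonneg (Nat.cast_nonneg _) (by linarith)
  have hq : (0 : ℝ × ℝ) ≤ (fibStep lam (-1))^[k - 1] p :=
    Function.Iterate.rec (fun q => (0 : ℝ × ℝ) ≤ q) hp (fun q hq => fibStep_nonneg _ _ hq) (k - 1)
  have h1 : sin (π / k) * p.1 ≤
      ∑ i ∈ Finset.range (k - 1), 2 * fibDefect lam ((fibStep lam (-1))^[i] p) := by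
    have h2 := mul_nonneg hlast hq.2
    refine (show sin (π / k) * p.1 ≤ _ by linarith).trans (hsum.symm.le.trans ?_)
    refine Finset.sum_le_sum fun i _ => ?_
    have h3 := mul_le_mul_of_nonneg_right (sin_le_one ((i + 1) * (π / k)))
      (fibDefect_nonneg lam ((fibStep lam (-1))^[i] p))
    linarith
  calc (1 / 2) ^ k * sin (π / k) * p.1 ≤ (1 / 2) ^ k *
        ∑ i ∈ Finset.range (k - 1), 2 * fibDefect lam ((fibStep lam (-1))^[i] p) := by
        rw [mul_assoc]; gcongr
    _ = ∑ i ∈ Finset.range (k - 1), (1 / 2) ^ k * 2 * fibDefect lam ((fibStep lam (-1))^[i] p) := by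
        rw [Finset.mul_sum]; simp only [mul_assoc]
    _ ≤ _ := by
        refine Finset.sum_le_sum fun i hi => ?_
        rw [Finset.mem_range] at hi
        refine le_trans ?_ (le_transfer_pow lam i (fun p _ => fibDefect_nonneg lam p) p hp)
        refine mul_le_mul_of_nonneg_right ?_ (fibDefect_nonneg _ _)
        calc (1 / 2 : ℝ) ^ k * 2 = (1 / 2) ^ (k - 1) := by
              conv_lhs => rw [← Nat.sub_add_cancel (by omega : 1 ≤ k), pow_succ]
              ring
          _ ≤ (1 / 2) ^ i := pow_le_pow_of_le_one (by norm_num) (by norm_num) hi.le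

/-- Compared with `lam`, the means gain at most a factor `1 + O(2⁻ᵏ)` in each step. -/
theorem meanFib_le_mul {k : ℕ} (hk : 3 ≤ k) {lam a b : ℝ}
    (hlam : lam = 2 * cos (π / k)) (hlam1 : 1 ≤ lam) (ha : 0 < a) (hb : 0 < b) (n : ℕ) :
    meanFib lam a b (n + k + 1) ≤ (lam + 8 * (1 / 2) ^ k) * meanFib lam a b (n + k) := by
  -- The last `L = k - 2` tosses before the new term are averaged first.
  obtain ⟨L, rfl⟩ : ∃ L, k = L + 2 := ⟨k - 2, by omega⟩
  have hlam0 : 0 ≤ lam := zero_le_one.trans hlam1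
  have hab : (0 : ℝ × ℝ) ≤ (a, b) := ⟨ha.le, hb.le⟩
  have hdef : (transfer lam ^ (n + 1 + L)) (fibDefect lam) (a, b) ≤
      (lam / 2) ^ L * (meanFib lam a b (n + 1) + meanFib lam a b (n + 2)) := by
    have h := transfer_pow_mono lam (n + 1) (f := (transfer lam ^ L) (fibDefect lam))
      (g := (lam / 2) ^ L • (Prod.fst + Prod.snd)) (fun p hp => ?_) _ hab
    · rw [map_smul, map_add] at h
      rw [pow_add, Module.End.mul_apply, meanFib_succ (n + 1)]
      exact h
    · refine (transfer_pow_fibDefect_le hk hlam hlam1 L le_rfl p hp).trans ?_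
      refine mul_le_mul_of_nonneg_left ?_ (by positivity)
      exact max_le (le_add_of_nonneg_right hp.2) (le_add_of_nonneg_left hp.1)
  have hmono : meanFib lam a b (n + 1) ≤ meanFib lam a b (n + 2) :=
    (le_mul_of_one_le_left (meanFib_pos (by linarith) ha hb _).le hlam1).trans
      (mul_meanFib_le hlam0 ha.le hb.le n)
  have hgrow := pow_mul_meanFib_le hlam0 ha.le hb.le (n + 1) L
  have h1 : (lam / 2) ^ L * (meanFib lam a b (n + 1) + meanFib lam a b (n + 2)) ≤
      8 * (1 / 2) ^ (L + 2) * meanFib lam a b (n + 1 + L + 1) := by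
    calc _ ≤ (lam / 2) ^ L * (2 * meanFib lam a b (n + 2)) := by gcongr; linarith
      _ = 8 * (1 / 2) ^ (L + 2) * (lam ^ L * meanFib lam a b (n + 1 + 1)) := by
        rw [div_pow, div_pow, one_pow]; field_simp; ring
      _ ≤ _ := by gcongr
  have h2 := meanFib_add_two hlam0 ha.le hb.le (n + 1 + L)
  have e1 : n + (L + 2) = n + 1 + L + 1 := by omega
  rw [e1, h2]
  linarith

/-- Compared with `lam ^ k`, the means gain at least a fixed amount in each `k` steps. -/
theorem mul_meanFib_le_add {k : ℕ} (hk : 3 ≤ k) {lam a b : ℝ}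
    (hlam : lam = 2 * cos (π / k)) (hlam1 : 1 ≤ lam) (ha : 0 < a) (hb : 0 < b) (n : ℕ) :
    (lam ^ k + (1 / 2) ^ k * sin (π / k)) * meanFib lam a b (n + 1) ≤
      meanFib lam a b (n + 1 + k) := by
  have hlam0 : 0 ≤ lam := zero_le_one.trans hlam1
  have hab : (0 : ℝ × ℝ) ≤ (a, b) := ⟨ha.le, hb.le⟩
  have h1 := pow_mul_add_sum_defect_le hlam1 ha.le hb.le (n + 1) (k - 1)
  have h2 : (1 / 2) ^ k * sin (π / k) * meanFib lam a b (n + 1) ≤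
      ∑ i ∈ Finset.range (k - 1), (transfer lam ^ (n + 1 + i)) (fibDefect lam) (a, b) := by
    have h := transfer_pow_mono lam (n + 1) (f := ((1 / 2) ^ k * sin (π / k)) • Prod.fst)
      (g := ∑ i ∈ Finset.range (k - 1), (transfer lam ^ i) (fibDefect lam))
      (fun p hp => by
        rw [Finset.sum_apply]; exact le_sum_transfer_pow_fibDefect hk hlam p hp) _ hab
    rw [map_smul, map_sum, Finset.sum_apply] at h
    simp only [pow_add (transfer lam) (n + 1), Module.End.mul_apply]
    exact h
  have h3 := mul_le_mul_of_nonneg_left (mul_meanFib_le hlam0 ha.le hb.le n)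
    (show 0 ≤ lam ^ (k - 1) by positivity)
  rw [← mul_assoc, ← pow_succ, Nat.sub_add_cancel (by omega : 1 ≤ k)] at h3
  have e : n + 1 + (k - 1) + 1 = n + 1 + k := by omega
  rw [e] at h1
  rw [add_mul]
  linarith

end Trig

/-! ### Growth rates -/

theorem tendsto_mul_pow_rpow_one_div {C q : ℝ} (hC : 0 < C) (hq : 0 ≤ q) :
    Tendsto (fun n : ℕ => (C * q ^ n) ^ ((1 : ℝ) / n)) atTop (𝓝 q) := by
  have h1 : Tendsto (fun n : ℕ => C ^ ((1 : ℝ) / n)) atTop (𝓝 1) := by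
    simpa [Function.comp_def] using (Real.continuousAt_const_rpow hC.ne').tendsto.comp
      (tendsto_one_div_atTop_nhds_zero_nat (𝕜 := ℝ))
  have h2 := h1.mul_const q
  rw [one_mul] at h2
  refine h2.congr' ?_
  filter_upwards [eventually_ge_atTop 1] with n hn
  rw [Real.mul_rpow hC.le (by positivity), one_div, Real.pow_rpow_inv_natCast hq (by omega)]

theorem growthRate_le {e : ℕ → ℝ} {r : ℝ}
    (hr : Tendsto (fun n : ℕ => e n ^ ((1 : ℝ) / n)) atTop (𝓝 r)) {C q : ℝ} (hC : 0 < C)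
    (hq : 0 ≤ q) (he : ∀ n, 0 ≤ e n) (h : ∀ᶠ n in atTop, e n ≤ C * q ^ n) : r ≤ q := by
  refine le_of_tendsto_of_tendsto hr (tendsto_mul_pow_rpow_one_div hC hq) ?_
  filter_upwards [h] with n hn
  exact Real.rpow_le_rpow (he n) hn (by positivity)

/-- A lower bound along the multiples of `k` suffices to bound the `k`-th power of the growth rate
below. -/
theorem le_growthRate_pow {e : ℕ → ℝ} {r : ℝ}
    (hr : Tendsto (fun n : ℕ => e n ^ ((1 : ℝ) / n)) atTop (𝓝 r)) {C q : ℝ} (hC : 0 < C)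
    (hq : 0 ≤ q) (he : ∀ n, 0 ≤ e n) {k : ℕ} (hk : 1 ≤ k)
    (h : ∀ᶠ t in atTop, C * q ^ t ≤ e (k * t)) : q ≤ r ^ k := by
  have hkt : Tendsto (fun t : ℕ => k * t) atTop atTop :=
    tendsto_id.const_mul_atTop' (by omega)
  refine le_of_tendsto_of_tendsto (tendsto_mul_pow_rpow_one_div hC hq)
    ((hr.comp hkt).pow k) ?_
  filter_upwards [h] with t ht
  have hroot : (e (k * t) ^ ((1 : ℝ) / (k * t : ℕ))) ^ k = e (k * t) ^ ((1 : ℝ) / t) := by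
    rw [← Real.rpow_mul_natCast (he _)]
    congr 1
    push_cast
    field_simp
  simp only [Function.comp_apply]
  rw [hroot]
  exact Real.rpow_le_rpow (by positivity) ht (by positivity)

section GrowthRate

variable {Ω : Type*} [MeasurableSpace Ω] {μ : Measure Ω} {X : ℕ → Ω → Bool}

/-- At `lam = 2 * cos (π / k)` the growth rate is larger than `lam`, but by an exponentially small
amount only. -/
theorem growthRate_two_mul_cos_bounds [IsProbabilityMeasure μ]
    (hX : IsCoinSequence μ (1 / 2) X) {k : ℕ} (hk : 3 ≤ k) {a b r : ℝ} (ha : 0 < a) (hb : 0 < b)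
    (hr : HasExpectedGrowthRate μ X (2 * Real.cos (Real.pi / k)) a b r) :
    2 * Real.cos (Real.pi / k) < r ∧ r ≤ 2 * Real.cos (Real.pi / k) + 8 * (1 / 2) ^ k := by
  have hk0 : (3 : ℝ) ≤ k := by exact_mod_cast hk
  have hcos : 1 / 2 ≤ Real.cos (Real.pi / k) := by
    rw [← Real.cos_pi_div_three]
    exact Real.cos_le_cos_of_nonneg_of_le_pi (by positivity) (by linarith [Real.pi_pos])
      (div_le_div_of_nonneg_left Real.pi_pos.le (by norm_num) hk0)
  obtain ⟨lam, hlam⟩ : ∃ lam, lam = 2 * Real.cos (Real.pi / k) := ⟨_, rfl⟩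
  rw [← hlam] at hr ⊢
  have hlam1 : 1 ≤ lam := by linarith
  have hlam0 : 0 < lam := by linarith
  have hpos : ∀ n, 0 ≤ expectedFib μ X lam a b n := by
    rintro (_ | n)
    · simp [expectedFib, randFib]
    · rw [expectedFib_succ hX]; exact (meanFib_pos hlam0 ha hb n).le
  have hsin : 0 < Real.sin (Real.pi / k) := by
    simpa using sin_mul_pi_div_pos (k := k) one_pos (by linarith)
  constructor
  · obtain ⟨q, hq⟩ : ∃ q, q = lam ^ k + (1 / 2) ^ k * Real.sin (Real.pi / k) := ⟨_, rfl⟩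
    have hq0 : 0 < q := by rw [hq]; positivity
    have hm := meanFib_pos hlam0 ha hb (k - 1)
    have hgrow : ∀ t : ℕ, q ^ t * meanFib lam a b (k - 1) ≤ meanFib lam a b (k * t + (k - 1)) := by
      intro t
      induction t with
      | zero => simp
      | succ t ih =>
        have h1 := mul_meanFib_le_add hk hlam hlam1 ha hb (k * t + (k - 2))
        have e1 : k * t + (k - 2) + 1 = k * t + (k - 1) := by omega
        have e2 : k * t + (k - 1) + k = k * (t + 1) + (k - 1) := by rw [mul_add]; omega
        rw [← hq, e1, e2] at h1
        rw [pow_succ', mul_assoc]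
        exact (mul_le_mul_of_nonneg_left ih hq0.le).trans h1
    have hqr : q ≤ r ^ k := by
      refine le_growthRate_pow hr (C := meanFib lam a b (k - 1) / q) (by positivity) hq0.le hpos
        (by omega) ?_
      filter_upwards [eventually_ge_atTop 1] with t ht
      obtain ⟨t, rfl⟩ : ∃ u, t = u + 1 := ⟨t - 1, by omega⟩
      have e : k * (t + 1) = k * t + (k - 1) + 1 := by rw [mul_add]; omega
      rw [e, expectedFib_succ hX]
      refine le_trans (le_of_eq ?_) (hgrow t)
      rw [pow_succ]
      field_simp
    have hr0 : 0 ≤ r := ge_of_tendsto' hr fun n => Real.rpow_nonneg (hpos n) _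
    refine lt_of_pow_lt_pow_left₀ k hr0 (lt_of_lt_of_le ?_ hqr)
    rw [hq]
    exact lt_add_of_pos_right _ (by positivity)
  · obtain ⟨q, hq⟩ : ∃ q, q = lam + 8 * (1 / 2) ^ k := ⟨_, rfl⟩
    have hq0 : 0 < q := by rw [hq]; positivity
    rw [← hq]
    have hm := meanFib_pos hlam0 ha hb k
    refine growthRate_le hr (C := meanFib lam a b k / q ^ (k + 1)) (by positivity) hq0.le hpos ?_
    filter_upwards [eventually_ge_atTop (k + 1)] with n hn
    obtain ⟨j, rfl⟩ : ∃ j, n = j + k + 1 := ⟨n - (k + 1), by omega⟩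
    rw [expectedFib_succ hX]
    have hgrow : meanFib lam a b (j + k) ≤ q ^ j * meanFib lam a b k := by
      induction j with
      | zero => simp
      | succ j ih =>
        have h1 := meanFib_le_mul hk hlam hlam1 ha hb j
        have e : j + 1 + k = j + k + 1 := by omega
        rw [e, pow_succ', mul_assoc]
        rw [← hq] at h1
        exact h1.trans (mul_le_mul_of_nonneg_left (ih (by omega)) hq0.le)
    refine hgrow.trans (le_of_eq ?_)
    field_simp
    ring

theorem four_div_sq_le_two_sub {k : ℕ} (hk : 1 ≤ k) :
    4 / (k : ℝ) ^ 2 ≤ 2 - 2 * Real.cos (Real.pi / k) := by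
  have hk0 : (1 : ℝ) ≤ k := by exact_mod_cast hk
  have hx : Real.pi / k = 2 * (Real.pi / (2 * k)) := by field_simp
  have hjordan := Real.mul_le_sin (x := Real.pi / (2 * k)) (by positivity)
    (div_le_div_of_nonneg_left Real.pi_pos.le (by norm_num) (by linarith))
  have e : 2 / Real.pi * (Real.pi / (2 * k)) = 1 / k := by field_simp
  rw [e] at hjordan
  have hsq := pow_le_pow_left₀ (by positivity) hjordan 2
  rw [hx, Real.cos_two_mul, Real.cos_sq']
  rw [div_pow, one_pow] at hsq
  have : 4 / (k : ℝ) ^ 2 = 4 * (1 / (k : ℝ) ^ 2) := by ring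
  linarith

theorem tendsto_two_mul_cos_pi_div :
    Tendsto (fun k : ℕ => 2 * Real.cos (Real.pi / k)) atTop (𝓝[<] 2) := by
  refine tendsto_nhdsWithin_iff.2 ⟨?_, ?_⟩
  · have h := (Real.continuous_cos.tendsto 0).comp
      (tendsto_const_div_atTop_nhds_zero_nat Real.pi)
    simpa using h.const_mul 2
  · filter_upwards [eventually_ge_atTop 1] with k hk
    have h1 := four_div_sq_le_two_sub hk
    have h2 : 0 < 4 / (k : ℝ) ^ 2 := by positivity
    exact Set.mem_Iio.2 (by linarith)

theorem isLittleO_half_pow_two_mul_cos (p : ℕ) :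
    (fun k : ℕ => (1 / 2 : ℝ) ^ k) =o[atTop]
      fun k : ℕ => (2 * Real.cos (Real.pi / k) - 2) ^ p := by
  have h1 : (fun k : ℕ => ((k : ℝ) ^ (2 * p) * (1 / 2 : ℝ) ^ k)) =o[atTop]
      fun _ : ℕ => (1 : ℝ) :=
    (Asymptotics.isLittleO_one_iff ℝ).2
      (tendsto_pow_const_mul_const_pow_of_lt_one (2 * p) (by norm_num) (by norm_num))
  have h2 : (fun k : ℕ => ((k : ℝ) ^ (2 * p))⁻¹) =O[atTop]
      fun k : ℕ => (2 * Real.cos (Real.pi / k) - 2) ^ p := by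
    refine Asymptotics.IsBigO.of_bound 1 ?_
    filter_upwards [eventually_ge_atTop 1] with k hk
    have h3 := four_div_sq_le_two_sub hk
    have h4 : ((k : ℝ) ^ 2)⁻¹ ≤ |2 * Real.cos (Real.pi / k) - 2| := by
      rw [abs_sub_comm]
      refine le_trans ?_ (h3.trans (le_abs_self _))
      rw [← one_div]
      gcongr
      norm_num
    rw [one_mul, norm_pow, Real.norm_eq_abs, Real.norm_eq_abs, abs_of_nonneg (by positivity),
      pow_mul, ← inv_pow]
    exact pow_le_pow_left₀ (by positivity) h4 p
  refine ((h1.mul_isBigO h2).congr' ?_ ?_)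
  · filter_upwards [eventually_ge_atTop 1] with k hk
    have : (k : ℝ) ≠ 0 := by positivity
    field_simp
  · exact Eventually.of_forall fun k => one_mul _

end GrowthRate

theorem corollary2 {Ω : Type*} [MeasurableSpace Ω] (μ : Measure Ω) [IsProbabilityMeasure μ]
    (X : ℕ → Ω → Bool) (hX : IsCoinSequence μ (1 / 2) X)
    (a b : ℝ) (ha : 0 < a) (hb : 0 < b) (G : ℝ → ℝ) (δ : ℝ) (hδ : 0 < δ)
    (hG : ∀ lam : ℝ, 2 - δ < lam → lam ≤ 2 → HasExpectedGrowthRate μ X lam a b (G lam)) :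
    (DifferentiableWithinAt ℝ G (Set.Iic 2) 2 → derivWithin G (Set.Iic 2) 2 = 1) ∧
    (∀ n : ℕ, ContDiffWithinAt ℝ n G (Set.Iic 2) 2 →
      ∀ i : ℕ, 2 ≤ i → i ≤ n → iteratedDerivWithin i G (Set.Iic 2) 2 = 0) ∧
    ¬ AnalyticWithinAt ℝ G (Set.Iic 2) 2 := by
  have hlim := tendsto_two_mul_cos_pi_div
  have hbounds : ∀ᶠ k : ℕ in atTop,
      2 * Real.cos (Real.pi / k) < G (2 * Real.cos (Real.pi / k)) ∧
      G (2 * Real.cos (Real.pi / k)) ≤ 2 * Real.cos (Real.pi / k) + 8 * (1 / 2) ^ k := by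
    filter_upwards [eventually_ge_atTop 3, hlim.eventually self_mem_nhdsWithin,
      (hlim.mono_right nhdsWithin_le_nhds).eventually (lt_mem_nhds (sub_lt_self 2 hδ))]
      with k hk hk2 hkδ
    exact growthRate_two_mul_cos_bounds hX hk ha hb (hG _ hkδ (le_of_lt hk2))
  refine regularity_of_flat_along hlim (fun p => ?_) (hbounds.mono fun k hk => hk.1.ne')
  refine Asymptotics.IsBigO.trans_isLittleO ?_ (isLittleO_half_pow_two_mul_cos p)
  refine Asymptotics.IsBigO.of_bound 8 ?_
  filter_upwards [hbounds] with k hk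
  rw [Real.norm_of_nonneg (by linarith [hk.1]), Real.norm_of_nonneg (by positivity)]
  linarith [hk.2]
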